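/- Let $V$ be a finite-dimensional real vector space. Let $C \subset V$ be an open convex cone, that is, a nonempty open convex subset with $\lambda C \subset C$ for all $\lambda > 0$, and assume that $C$ is nondegenerate, i.e. that $C$ contains no affine line. Let $L \subset V$ be a lattice, i.e. a discrete subgroup that spans $V$ over $\mathbb{R}$, and equip $V$ with the rational structure $V(\mathbb{Q}) = \mathbb{Q} L$. A rational polyhedron is a subset of $V$ of the form $\{x \in V : f_1(x) \ge 0, \dots, f_k(x) \ge 0\}$, where $k \ge 0$ and $f_1, \dots, f_k : V \to \mathbb{R}$ are affine-linear functions with $f_i(V(\mathbb{Q})) \subset \mathbb{Q}$. Let $[C \cap L]$ denote the convex hull of $C \cap L$. Then $[C\cap L]$ is boundedly rationally polyhedral: for every bounded rational polyhedron $\Pi \subset V$, the intersection $[C \cap L] \cap \Pi$ is a rational polyhedron. In particular, $[C \cap L]$ is closed in $V$. -/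

import Mathlib

/-- A subset of a real vector space is nondegenerate if it contains no affine line. -/
def IsNondegenerate {V : Type*} [AddCommGroup V] [Module ℝ V] (X : Set V) : Prop :=
  ¬ ∃ x v : V, v ≠ 0 ∧ ∀ t : ℝ, x + t • v ∈ X

/-- The rational points of `V` for the rational structure defined by a lattice `L`:
the rational span of `L`, i.e. the vectors having a positive integer multiple in `L`. -/
def rationalPoints {V : Type*} [AddCommGroup V] (L : Submodule ℤ V) : Set V :=
  {x | ∃ n : ℤ, 0 < n ∧ n • x ∈ L}

/-- An affine-linear form on `V` is defined over the rationals (for the rational structure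
defined by `L`) if it takes rational values at the rational points. -/
def IsRationalForm {V : Type*} [AddCommGroup V] [Module ℝ V] (L : Submodule ℤ V)
    (f : V →ᵃ[ℝ] ℝ) : Prop :=
  ∀ x ∈ rationalPoints L, ∃ q : ℚ, f x = (q : ℝ)

/-- A rational polyhedron: a subset that can be defined by finitely many affine-linear
inequalities `0 ≤ f x` with all `f` defined over the rationals. -/
def IsRationalPolyhedron {V : Type*} [AddCommGroup V] [Module ℝ V] (L : Submodule ℤ V)
    (P : Set V) : Prop :=
  ∃ S : Finset (V →ᵃ[ℝ] ℝ), (∀ f ∈ S, IsRationalForm L f) ∧ P = {x | ∀ f ∈ S, 0 ≤ f x}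

/-- A subset is boundedly rationally polyhedral if its intersection with every bounded rational
polyhedron is a rational polyhedron. -/
def IsBoundedlyRationallyPolyhedral {V : Type*} [NormedAddCommGroup V] [NormedSpace ℝ V]
    (L : Submodule ℤ V) (K : Set V) : Prop :=
  ∀ P : Set V, IsRationalPolyhedron L P → Bornology.IsBounded P → IsRationalPolyhedron L (K ∩ P)

/-! It suffices that each bounded part of the hull lies in the hull of a finite `F ⊆ C ∩ L`
(`exists_finset_forall_mem_convexHull`): bounded parts then agree with those of a lattice polytope,
which is compact, and rational by Fourier-Motzkin elimination.

The main input is `exists_finset_cone_of_finrank`: seen from a lattice point `p` of `C`, all far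
lattice points of `C` lie in a finitely generated cone. Directions being compact, work near one
direction `y`. Kronecker's theorem gives a subspace `W` containing `y` whose lattice points
approximate every translate of the ray within `W`. Take generators near that ray, plus lifts of
generators for `V ⧸ W`. A form `φ` nonnegative on all `f - p` either is positive at `y`, hence large
at far points near direction `y`, or vanishes on `W` and is handled by induction on dimension.

Nondegeneracy supplies a form `η` bounding the norm on `C`. In a Carathéodory combination for a
bounded `x`, a point `p` of largest weight is then bounded. Rewriting the other points as `p` plus
multiples of `f - p`, with `η f` large, keeps the total weight at most 1. -/

open scoped NNReal

/-! ### Finitely generated cones as intersections of half-spaces -/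

/-- Fourier-Motzkin elimination of one generator. -/
theorem exists_add_smul_mem_iff {E : Type*} [AddCommGroup E] [Module ℝ E]
    (Φ : Finset (E →ₗ[ℝ] ℝ)) (g x : E) :
    (∃ s : ℝ, 0 ≤ s ∧ ∀ φ ∈ Φ, 0 ≤ φ (x - s • g)) ↔
      (∀ φ ∈ Φ, 0 ≤ φ g → 0 ≤ φ x) ∧
      (∀ φ ∈ Φ, ∀ ψ ∈ Φ, 0 < φ g → ψ g < 0 → 0 ≤ φ g * ψ x - ψ g * φ x) := by
  constructor
  · rintro ⟨s, hs, h⟩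
    have h' : ∀ φ ∈ Φ, s * φ g ≤ φ x := fun φ hφ ↦ by simpa using h φ hφ
    refine ⟨fun φ hφ hg ↦ (mul_nonneg hs hg).trans (h' φ hφ), fun φ hφ ψ hψ hp hn ↦ ?_⟩
    nlinarith [h' φ hφ, h' ψ hψ]
  · rintro ⟨h1, h2⟩
    classical
    -- Forms negative at `g` bound `s` from below. The witness is the largest lower bound, with 0
    -- inserted for `0 ≤ s`.
    set N := (Φ.filter fun ψ ↦ ψ g < 0).image (fun ψ ↦ ψ x / ψ g) with hN
    have hne : (insert 0 N).Nonempty := Finset.insert_nonempty _ _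
    refine ⟨(insert 0 N).max' hne, Finset.le_max' _ _ (Finset.mem_insert_self _ _), ?_⟩
    intro φ hφ
    have hm := Finset.max'_mem (insert 0 N) hne
    set s := (insert 0 N).max' hne
    rw [map_sub, map_smul, smul_eq_mul, sub_nonneg]
    rcases lt_trichotomy (φ g) 0 with hg | hg | hg
    · have : φ x / φ g ≤ s := Finset.le_max' _ _ <| Finset.mem_insert_of_mem <|
        Finset.mem_image_of_mem (fun ψ : E →ₗ[ℝ] ℝ ↦ ψ x / ψ g) (Finset.mem_filter.2 ⟨hφ, hg⟩)
      rwa [div_le_iff_of_neg hg] at this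
    · simpa [hg] using h1 φ hφ hg.ge
    · rcases Finset.mem_insert.1 hm with h0 | h0
      · rw [h0]; simpa using h1 φ hφ hg.le
      · simp only [hN, Finset.mem_image, Finset.mem_filter] at h0
        obtain ⟨ψ, ⟨hψ, hψg⟩, he⟩ := h0
        have h3 := h2 φ hφ ψ hψ hg hψg
        have h4 : s * ψ g = ψ x := by rw [← he, div_mul_cancel₀ _ hψg.ne]
        nlinarith

/-- A cone generated by finitely many vectors from `Γ` is cut out by finitely many linear
forms with values in `K` on `Γ`. -/
theorem exists_finset_forms_span_nnreal {E : Type*} [AddCommGroup E] [Module ℝ E]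
    (K : Subring ℝ) (Γ : Set E)
    (hΓ : ∃ Φ : Finset (E →ₗ[ℝ] ℝ), (∀ φ ∈ Φ, ∀ x ∈ Γ, φ x ∈ K) ∧
      ∀ x, (∀ φ ∈ Φ, φ x = 0) → x = 0)
    (G : Finset E) (hG : ∀ g ∈ G, g ∈ Γ) :
    ∃ Φ : Finset (E →ₗ[ℝ] ℝ), (∀ φ ∈ Φ, ∀ x ∈ Γ, φ x ∈ K) ∧
      ∀ x, x ∈ Submodule.span ℝ≥0 (G : Set E) ↔ ∀ φ ∈ Φ, 0 ≤ φ x := by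
  classical
  induction G using Finset.induction_on with
  | empty =>
    obtain ⟨Φ, hq, h0⟩ := hΓ
    refine ⟨Φ ∪ Φ.image (fun φ ↦ -φ), ?_, fun x ↦ ?_⟩
    · intro φ hφ x hx
      rcases Finset.mem_union.1 hφ with h | h
      · exact hq φ h x hx
      · obtain ⟨ψ, hψ, rfl⟩ := Finset.mem_image.1 h
        exact K.neg_mem (hq ψ hψ x hx)
    · simp only [Finset.coe_empty, Submodule.span_empty, Submodule.mem_bot]
      constructor
      · rintro rfl; simp
      · intro h
        refine h0 x fun φ hφ ↦ le_antisymm ?_ (h φ (Finset.mem_union_left _ hφ))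
        have := h (-φ) (Finset.mem_union_right _ (Finset.mem_image_of_mem _ hφ))
        simpa using this
  | insert g G hg ih =>
    obtain ⟨Φ, hq, h⟩ := ih fun x hx ↦ hG x (Finset.mem_insert_of_mem hx)
    obtain hgΓ := hG g (Finset.mem_insert_self _ _)
    -- The coefficients of each combination are values at `g ∈ Γ`, so the new forms stay `K`-valued
    -- on `Γ` without any division.
    refine ⟨Φ.filter (fun φ ↦ 0 ≤ φ g) ∪
      ((Φ.filter (fun φ ↦ 0 < φ g)) ×ˢ (Φ.filter (fun φ ↦ φ g < 0))).image
        (fun p ↦ p.1 g • p.2 - p.2 g • p.1), ?_, fun x ↦ ?_⟩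
    · intro φ hφ x hx
      rcases Finset.mem_union.1 hφ with h | h
      · exact hq φ (Finset.mem_filter.1 h).1 x hx
      · obtain ⟨⟨a, b⟩, hp, rfl⟩ := Finset.mem_image.1 h
        simp only [Finset.mem_product, Finset.mem_filter] at hp
        exact K.sub_mem (K.mul_mem (hq a hp.1.1 g hgΓ) (hq b hp.2.1 x hx))
          (K.mul_mem (hq b hp.2.1 g hgΓ) (hq a hp.1.1 x hx))
    · have e1 : x ∈ Submodule.span ℝ≥0 ((insert g G : Finset E) : Set E) ↔
          ∃ s : ℝ, 0 ≤ s ∧ ∀ φ ∈ Φ, 0 ≤ φ (x - s • g) := by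
        rw [Finset.coe_insert, Submodule.mem_span_insert]
        constructor
        · rintro ⟨a, z, hz, rfl⟩
          refine ⟨a, a.2, (h _).1 ?_⟩
          have : a • g + z - (a : ℝ) • g = z := by rw [NNReal.smul_def]; abel
          rwa [this]
        · rintro ⟨s, hs, hx⟩
          exact ⟨s.toNNReal, x - s • g, (h _).2 hx, by
            rw [NNReal.smul_def, Real.coe_toNNReal s hs]; simp⟩
      rw [e1, exists_add_smul_mem_iff]
      simp only [Finset.mem_union, Finset.mem_filter, Finset.mem_image, Finset.mem_product,
        Prod.exists]
      constructor
      · rintro ⟨h1, h2⟩ φ (⟨hφ, hp⟩ | ⟨a, b, ⟨⟨ha, ha'⟩, hb, hb'⟩, rfl⟩)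
        · exact h1 φ hφ hp
        · simpa using h2 a ha b hb ha' hb'
      · intro h1
        refine ⟨fun φ hφ hp ↦ h1 φ (Or.inl ⟨hφ, hp⟩), fun φ hφ ψ hψ hp hn ↦ ?_⟩
        simpa using h1 _ (Or.inr ⟨φ, ψ, ⟨⟨hφ, hp⟩, hψ, hn⟩, rfl⟩)

/-- In finite dimension finitely many linear forms separate the points. -/
theorem exists_finset_forms_separating (E : Type*) [AddCommGroup E] [Module ℝ E]
    [FiniteDimensional ℝ E] :
    ∃ Φ : Finset (E →ₗ[ℝ] ℝ), ∀ x, (∀ φ ∈ Φ, φ x = 0) → x = 0 := by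
  classical
  let b := Module.finBasis ℝ E
  refine ⟨Finset.univ.image b.coord, fun x hx ↦ ?_⟩
  refine b.ext_elem fun i ↦ ?_
  simpa using hx (b.coord i) (by simp)

theorem exists_finset_forms_span_nnreal_finite {E : Type*} [AddCommGroup E] [Module ℝ E]
    [FiniteDimensional ℝ E] (G : Finset E) :
    ∃ Φ : Finset (E →ₗ[ℝ] ℝ), ∀ x, x ∈ Submodule.span ℝ≥0 (G : Set E) ↔ ∀ φ ∈ Φ, 0 ≤ φ x := by
  obtain ⟨Φ, hΦ⟩ := exists_finset_forms_separating E
  obtain ⟨Ψ, -, h⟩ := exists_finset_forms_span_nnreal (⊤ : Subring ℝ) Set.univ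
    ⟨Φ, by simp, hΦ⟩ G (by simp)
  exact ⟨Ψ, h⟩

/-! ### Lattices and Diophantine approximation -/

/-- A subgroup with finitely many points in each ball, and meeting every ball of some radius. -/
structure IsUniformLattice {V : Type*} [NormedAddCommGroup V] (L : Submodule ℤ V) : Prop where
  finite : ∀ R : ℝ, {l | l ∈ L ∧ ‖l‖ ≤ R}.Finite
  cobounded : ∃ R : ℝ, ∀ v, ∃ l ∈ L, ‖v - l‖ ≤ R

/-- An additive subgroup is cobounded in its real span. -/
theorem exists_norm_sub_le_of_mem_span {V : Type*} [NormedAddCommGroup V] [NormedSpace ℝ V]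
    [FiniteDimensional ℝ V] (L : Submodule ℤ V) :
    ∃ R : ℝ, ∀ w ∈ Submodule.span ℝ (L : Set V), ∃ l ∈ L, ‖w - l‖ ≤ R := by
  obtain ⟨f, hf, hs, -⟩ := Submodule.exists_fun_fin_finrank_span_eq ℝ (L : Set V)
  refine ⟨∑ i, ‖f i‖, fun w hw ↦ ?_⟩
  rw [← hs, Submodule.mem_span_range_iff_exists_fun] at hw
  obtain ⟨c, rfl⟩ := hw
  refine ⟨∑ i, ⌊c i⌋ • f i, Submodule.sum_mem _ fun i _ ↦ L.smul_mem _ (hf i), ?_⟩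
  rw [← Finset.sum_sub_distrib]
  refine (norm_sum_le _ _).trans (Finset.sum_le_sum fun i _ ↦ ?_)
  rw [← Int.cast_smul_eq_zsmul ℝ, ← sub_smul, norm_smul]
  refine mul_le_of_le_one_left (norm_nonneg _) ?_
  rw [Int.self_sub_floor, Real.norm_eq_abs, Int.abs_fract]
  exact (Int.fract_lt_one _).le

theorem isUniformLattice_of_isZLattice {V : Type*} [NormedAddCommGroup V] [NormedSpace ℝ V]
    [FiniteDimensional ℝ V] (L : Submodule ℤ V) [DiscreteTopology L] [IsZLattice ℝ L] :
    IsUniformLattice L := by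
  constructor
  · intro R
    have : ProperSpace V := FiniteDimensional.proper ℝ V
    have hd : DiscreteTopology L.toAddSubgroup := inferInstanceAs (DiscreteTopology L)
    have hc : IsClosed (L : Set V) := AddSubgroup.isClosed_of_discrete (H := L.toAddSubgroup)
    have := Metric.finite_isBounded_inter_isClosed (K := Metric.closedBall (0 : V) R)
      (s := (L : Set V)) ⟨inferInstanceAs (DiscreteTopology L)⟩ Metric.isBounded_closedBall hc
    refine this.subset fun l hl ↦ ⟨by simpa using hl.2, hl.1⟩
  · obtain ⟨R, hR⟩ := exists_norm_sub_le_of_mem_span L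
    exact ⟨R, fun v ↦ hR v (by rw [IsZLattice.span_top]; trivial)⟩

/-- Simultaneous Diophantine approximation: a line through `0` returns to a lattice. -/
theorem IsUniformLattice.exists_norm_sub_smul_lt {V : Type*} [NormedAddCommGroup V]
    [NormedSpace ℝ V] [FiniteDimensional ℝ V] {L : Submodule ℤ V} (hL : IsUniformLattice L)
    (y : V) {ε : ℝ} (hε : 0 < ε) (T : ℝ) :
    ∃ l ∈ L, ∃ t : ℝ, T ≤ t ∧ ‖l - t • y‖ < ε := by
  have : ProperSpace V := FiniteDimensional.proper ℝ V
  obtain ⟨R, hR⟩ := hL.cobounded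
  choose l hl hlR using fun n : ℕ ↦ hR ((n : ℝ) • y)
  obtain ⟨a, -, φ, hφ, ha⟩ := (isCompact_closedBall (0 : V) R).tendsto_subseq
    (x := fun n ↦ (n : ℝ) • y - l n) (fun n ↦ by simpa using hlR n)
  obtain ⟨N, hN⟩ := Metric.cauchySeq_iff.1 ha.cauchySeq ε hε
  set j := ⌈T⌉₊ + N
  -- `φ` is strictly increasing, so shifting the index by `⌈T⌉₊` delays the return by at least `T`.
  have hj : ⌈T⌉₊ + φ N ≤ φ j := hφ.add_le_nat _ _
  refine ⟨l (φ j) - l (φ N), L.sub_mem (hl _) (hl _), (φ j : ℝ) - φ N, ?_, ?_⟩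
  · have h1 : ((⌈T⌉₊ + φ N : ℕ) : ℝ) ≤ φ j := by exact_mod_cast hj
    push_cast at h1
    linarith [Nat.le_ceil T]
  · have := hN N le_rfl j (by omega)
    rw [dist_eq_norm] at this
    have e : l (φ j) - l (φ N) - ((φ j : ℝ) - φ N) • y =
        ((φ N : ℝ) • y - l (φ N)) - ((φ j : ℝ) • y - l (φ j)) := by
      rw [sub_smul]; abel
    rw [e]
    exact this

/-- Kronecker's theorem: every vector `y` lies in a subspace `W` such that the lattice points
of `W` approximate all translates of the rays spanned by `y` within `W`. -/
theorem IsUniformLattice.exists_submodule_dense {V : Type*} [NormedAddCommGroup V]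
    [NormedSpace ℝ V] [FiniteDimensional ℝ V] {L : Submodule ℤ V} (hL : IsUniformLattice L)
    (y : V) :
    ∃ W : Submodule ℝ V, y ∈ W ∧ ∀ w ∈ W, ∀ ε : ℝ, 0 < ε → ∀ T : ℝ,
      ∃ l ∈ L, l ∈ W ∧ ∃ t : ℝ, T ≤ t ∧ ‖l - t • y - w‖ < ε := by
  -- The spans of the short vectors of `L + ℝy` shrink with `ε` and stabilise once their dimension
  -- is minimal. The stable span plus `ℝy` is `W`.
  set G : ℝ → Set V := fun ε ↦ {v | ‖v‖ < ε ∧ ∃ l ∈ L, ∃ t : ℝ, v = l - t • y} with hG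
  set U : ℝ → Submodule ℝ V := fun ε ↦ Submodule.span ℝ (G ε) with hU
  have hmono : ∀ a b, a ≤ b → U a ≤ U b := fun a b hab ↦
    Submodule.span_mono fun v hv ↦ ⟨hv.1.trans_le hab, hv.2⟩
  have hS : {n : ℕ | ∃ ε : ℝ, 0 < ε ∧ Module.finrank ℝ (U ε) = n}.Nonempty := ⟨_, 1, one_pos, rfl⟩
  obtain ⟨ε₀, hε₀, hmin⟩ := Nat.sInf_mem hS
  have hstab : ∀ ε, 0 < ε → ε ≤ ε₀ → U ε = U ε₀ := fun ε hε hle ↦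
    Submodule.eq_of_le_of_finrank_le (hmono _ _ hle) (by rw [hmin]; exact Nat.sInf_le ⟨ε, hε, rfl⟩)
  have hyW : y ∈ U ε₀ ⊔ Submodule.span ℝ {y} :=
    Submodule.mem_sup_right (Submodule.mem_span_singleton_self y)
  refine ⟨U ε₀ ⊔ Submodule.span ℝ {y}, hyW, fun w hw ε hε T ↦ ?_⟩
  obtain ⟨u, hu, z, hz, rfl⟩ := Submodule.mem_sup.1 hw
  obtain ⟨s, rfl⟩ := Submodule.mem_span_singleton.1 hz
  -- Rounding the coefficients of at most `n` vectors shorter than `ε₁` costs at most `ε / 2`.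
  set n := Module.finrank ℝ V
  set ε₁ := min ε₀ (ε / (2 * (n + 1))) with hε₁
  have hε₁0 : 0 < ε₁ := lt_min hε₀ (by positivity)
  rw [← hstab ε₁ hε₁0 (min_le_left _ _)] at hu
  obtain ⟨f, hf, hs, hli⟩ := Submodule.exists_fun_fin_finrank_span_eq ℝ (G ε₁)
  have hk : Module.finrank ℝ (Submodule.span ℝ (G ε₁)) ≤ n := Submodule.finrank_le _
  simp only [hU] at hu
  rw [← hs, Submodule.mem_span_range_iff_exists_fun] at hu
  obtain ⟨c, rfl⟩ := hu
  choose l hl t ht using fun i ↦ (hf i).2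
  -- A late return `t₀` makes the total time at least `T`. The bound `ε₀` keeps `l₀` in `W`; the
  -- bound `ε / 2` controls the remaining error.
  obtain ⟨l₀, hl₀, t₀, ht₀, hlt₀⟩ := hL.exists_norm_sub_smul_lt y
    (lt_min hε₀ (half_pos hε)) (T - ∑ i, ⌊c i⌋ * t i + s)
  set v := ∑ i, ⌊c i⌋ • f i with hv
  have hvl : v = (∑ i, ⌊c i⌋ • l i) - (∑ i, ⌊c i⌋ * t i) • y := by
    rw [hv, Finset.sum_smul, ← Finset.sum_sub_distrib]
    refine Finset.sum_congr rfl fun i _ ↦ ?_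
    rw [ht i, smul_sub, mul_smul, Int.cast_smul_eq_zsmul]
  have hvU : v ∈ U ε₀ := by
    refine Submodule.sum_mem _ fun i _ ↦ ?_
    rw [← Int.cast_smul_eq_zsmul ℝ]
    refine Submodule.smul_mem _ _ ?_
    rw [← hstab ε₁ hε₁0 (min_le_left _ _)]
    exact Submodule.subset_span (hf i)
  have hvn : ‖(∑ i, c i • f i) - v‖ ≤ ε / 2 := by
    rw [hv, ← Finset.sum_sub_distrib]
    calc ‖∑ i, (c i • f i - ⌊c i⌋ • f i)‖ ≤
        ∑ _i : Fin (Module.finrank ℝ (Submodule.span ℝ (G ε₁))), ε₁ := by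
          refine (norm_sum_le _ _).trans (Finset.sum_le_sum fun i _ ↦ ?_)
          rw [← Int.cast_smul_eq_zsmul ℝ, ← sub_smul, norm_smul]
          refine (mul_le_of_le_one_left (norm_nonneg _) ?_).trans (hf i).1.le
          rw [Int.self_sub_floor, Real.norm_eq_abs, Int.abs_fract]
          exact (Int.fract_lt_one _).le
      _ = Module.finrank ℝ (Submodule.span ℝ (G ε₁)) * ε₁ := by simp
      _ ≤ (n + 1) * (ε / (2 * (n + 1))) := by
          refine mul_le_mul ?_ (min_le_right _ _) hε₁0.le (by positivity)
          exact_mod_cast hk.trans (Nat.le_succ n)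
      _ = ε / 2 := by field_simp
  refine ⟨(∑ i, ⌊c i⌋ • l i) + l₀, L.add_mem (L.sum_mem fun i _ ↦ L.smul_mem _ (hl i)) hl₀, ?_,
    (∑ i, ⌊c i⌋ * t i) + t₀ - s, by linarith, ?_⟩
  · refine Submodule.add_mem _ ?_ ?_
    · rw [← sub_add_cancel (∑ i, ⌊c i⌋ • l i) ((∑ i, ⌊c i⌋ * t i) • y), ← hvl]
      exact Submodule.add_mem _ (Submodule.mem_sup_left hvU) (Submodule.smul_mem _ _ hyW)
    · rw [← sub_add_cancel l₀ (t₀ • y)]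
      refine Submodule.add_mem _ (Submodule.mem_sup_left (Submodule.subset_span ?_))
        (Submodule.smul_mem _ _ hyW)
      exact ⟨hlt₀.trans_le (min_le_left _ _), l₀, hl₀, t₀, rfl⟩
  · have : (∑ i, ⌊c i⌋ • l i) + l₀ - ((∑ i, ⌊c i⌋ * t i) + t₀ - s) • y -
        (∑ i, c i • f i + s • y) = (l₀ - t₀ • y) - ((∑ i, c i • f i) - v) := by
      rw [hvl, sub_smul, add_smul]; abel
    rw [this]
    have h2 := hlt₀.trans_le (min_le_right _ _)
    linarith [norm_sub_le (l₀ - t₀ • y) ((∑ i, c i • f i) - v)]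

/-! ### Far lattice points in an open cone -/

/-- Finitely many lattice points near the ray of `y` detect whether a functional that is
nonpositive at `y` vanishes on `W`. -/
theorem exists_finset_near_ray {V : Type*} [NormedAddCommGroup V]
    [NormedSpace ℝ V] [FiniteDimensional ℝ V] {L : Submodule ℤ V} {y : V} {W : Submodule ℝ V}
    (hy : y ∈ W) (hW : ∀ w ∈ W, ∀ ε : ℝ, 0 < ε → ∀ T : ℝ,
      ∃ l ∈ L, l ∈ W ∧ ∃ t : ℝ, T ≤ t ∧ ‖l - t • y - w‖ < ε)
    {ε : ℝ} (hε : 0 < ε) (T : ℝ) :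
    ∃ N : Finset V, (∀ l ∈ N, l ∈ L ∧ l ∈ W ∧ ∃ t : ℝ, T ≤ t ∧ ‖l - t • y‖ < ε) ∧
      ∀ φ : V →ₗ[ℝ] ℝ, (∀ l ∈ N, 0 ≤ φ l) → φ y ≤ 0 → ∀ w ∈ W, φ w = 0 := by
  classical
  set b := Module.finBasis ℝ W
  set k := Module.finrank ℝ W
  set A : W →L[ℝ] (Fin k → ℝ) := LinearMap.toContinuousLinearMap b.equivFun.toLinearMap
  set κ := ‖A‖
  have hκ : 0 ≤ κ := norm_nonneg A
  set D := ∑ i, ‖b i‖ with hD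
  have hD0 : 0 ≤ D := Finset.sum_nonneg fun i _ ↦ norm_nonneg _
  set δ := ε / (2 * (D + 1)) with hδ
  have hδ0 : 0 < δ := by positivity
  have hδb : ∀ i, ‖δ • (b i : V)‖ ≤ ε / 2 := fun i ↦ by
    have h1 : ‖b i‖ ≤ D := Finset.single_le_sum (f := fun i ↦ ‖b i‖)
      (fun i _ ↦ norm_nonneg _) (Finset.mem_univ i)
    rw [norm_smul, Real.norm_of_nonneg hδ0.le]
    calc δ * ‖(b i : V)‖ ≤ δ * (D + 1) := by
          gcongr; exact h1.trans (by linarith)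
      _ = ε / 2 := by rw [hδ]; field_simp
  -- This makes `k * κ * θ < δ`, so that `δ * m ≤ k * κ * θ * m` will force `m = 0`. The error is
  -- measured against `m = ∑ i, |φ (b i)|`, so `N` does not depend on `φ`.
  set θ := min (ε / 2) (δ / (2 * (k * κ + 1))) with hθ
  have hθ0 : 0 < θ := lt_min (half_pos hε) (by positivity)
  have hbd : ∀ (φ : V →ₗ[ℝ] ℝ) (e : V), e ∈ W → ‖e‖ < θ →
      |φ e| ≤ κ * θ * ∑ i, |φ (b i)| := by
    intro φ e he hn
    have h1 : e = ∑ i, A ⟨e, he⟩ i • (b i : V) := by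
      have h := congrArg W.subtype (b.sum_equivFun ⟨e, he⟩)
      rw [map_sum] at h
      simp only [map_smul, Submodule.subtype_apply] at h
      exact h.symm
    have h2 : ∀ i, |A ⟨e, he⟩ i| ≤ κ * θ := fun i ↦ by
      refine (norm_le_pi_norm (A ⟨e, he⟩) i).trans ((A.le_opNorm _).trans ?_)
      gcongr
      exact hn.le
    conv_lhs => rw [h1]
    rw [map_sum, Finset.mul_sum]
    refine (Finset.abs_sum_le_sum_abs _ _).trans (Finset.sum_le_sum fun i _ ↦ ?_)
    rw [map_smul, smul_eq_mul, abs_mul]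
    gcongr
    exact h2 i
  -- Lattice points near `t • y ± δ • b i` bound `φ (b i)` on both sides; nonnegative times ensure
  -- `t * φ y ≤ 0`.
  choose lp hlpL hlpW tp htp hlp using fun i ↦
    hW (δ • (b i : V)) (W.smul_mem _ (b i).2) θ hθ0 (max T 0)
  choose ln hlnL hlnW tn htn hln using fun i ↦
    hW (-(δ • (b i : V))) (W.neg_mem (W.smul_mem _ (b i).2)) θ hθ0 (max T 0)
  have hθε : θ ≤ ε / 2 := min_le_left _ _
  refine ⟨Finset.univ.image lp ∪ Finset.univ.image ln, fun l hl ↦ ?_, fun φ hφ hφy ↦ ?_⟩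
  · simp only [Finset.mem_union, Finset.mem_image, Finset.mem_univ, true_and] at hl
    rcases hl with ⟨i, rfl⟩ | ⟨i, rfl⟩
    · refine ⟨hlpL i, hlpW i, tp i, (le_max_left _ _).trans (htp i), ?_⟩
      have := norm_add_le (lp i - tp i • y - δ • (b i : V)) (δ • (b i : V))
      rw [sub_add_cancel] at this
      linarith [hδb i, hlp i]
    · refine ⟨hlnL i, hlnW i, tn i, (le_max_left _ _).trans (htn i), ?_⟩
      have := norm_sub_le (ln i - tn i • y - -(δ • (b i : V))) (δ • (b i : V))
      rw [sub_neg_eq_add, add_sub_cancel_right] at this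
      linarith [hδb i, hln i, sub_neg_eq_add (ln i - tn i • y) (δ • (b i : V)) ▸ hln i]
  · set m := ∑ i, |φ (b i)| with hm
    have hm0 : 0 ≤ m := Finset.sum_nonneg fun i _ ↦ abs_nonneg _
    have key : ∀ i, δ * |φ (b i)| ≤ κ * θ * m := fun i ↦ by
      have h1 := hbd φ _ (W.sub_mem (W.sub_mem (hlpW i) (W.smul_mem (tp i) hy))
        (W.smul_mem δ (b i).2)) (hlp i)
      have h2 := hbd φ _ (W.sub_mem (W.sub_mem (hlnW i) (W.smul_mem (tn i) hy))
        (W.neg_mem (W.smul_mem δ (b i).2))) (hln i)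
      simp only [map_sub, map_neg, map_smul, smul_eq_mul] at h1 h2
      have h3 : 0 ≤ φ (lp i) := hφ _ (by simp)
      have h4 : 0 ≤ φ (ln i) := hφ _ (by simp)
      have h5 : tp i * φ y ≤ 0 :=
        mul_nonpos_of_nonneg_of_nonpos ((le_max_right _ _).trans (htp i)) hφy
      have h6 : tn i * φ y ≤ 0 :=
        mul_nonpos_of_nonneg_of_nonpos ((le_max_right _ _).trans (htn i)) hφy
      have h1' := (abs_le.1 h1).2
      have h2' := (abs_le.1 h2).2
      rw [← abs_of_pos hδ0, ← abs_mul, abs_le]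
      constructor <;> linarith
    have hsum : δ * m ≤ k * (κ * θ * m) := by
      rw [hm, Finset.mul_sum, ← hm]
      refine (Finset.sum_le_sum fun i _ ↦ key i).trans ?_
      simp
    have hlt : k * κ * θ < δ := by
      have h0 : 0 ≤ k * κ := by positivity
      calc k * κ * θ ≤ (k * κ + 1) * (δ / (2 * (k * κ + 1))) :=
            mul_le_mul (by linarith) (min_le_right _ _) hθ0.le (by positivity)
        _ = δ / 2 := by field_simp
        _ < δ := half_lt_self hδ0
    have hm' : m = 0 := by nlinarith
    have hb0 : ∀ i, φ (b i) = 0 := fun i ↦ by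
      have := (Finset.sum_eq_zero_iff_of_nonneg fun i _ ↦ abs_nonneg (φ (b i))).1 hm' i
        (Finset.mem_univ i)
      exact abs_eq_zero.1 this
    intro w hw
    have : φ.comp W.subtype = 0 := b.ext fun i ↦ by simpa using hb0 i
    simpa using LinearMap.congr_fun this ⟨w, hw⟩

/-- The image of a uniform lattice modulo a subspace spanned by lattice points is a uniform
lattice. -/
theorem IsUniformLattice.map_mkQ {V : Type*} [NormedAddCommGroup V]
    [NormedSpace ℝ V] [FiniteDimensional ℝ V] {L : Submodule ℤ V} (hL : IsUniformLattice L)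
    (W : Submodule ℝ V) [IsClosed (W : Set V)]
    (hW : W ≤ Submodule.span ℝ {l | l ∈ L ∧ l ∈ W}) :
    IsUniformLattice (L.map (W.mkQ.restrictScalars ℤ)) := by
  constructor
  · intro R
    obtain ⟨R', hR'⟩ := exists_norm_sub_le_of_mem_span (L ⊓ W.restrictScalars ℤ)
    refine ((hL.finite (R + 1 + R')).image W.mkQ).subset ?_
    rintro q ⟨hq, hqR⟩
    obtain ⟨l, hl, rfl⟩ := Submodule.mem_map.1 hq
    -- The short representative `v` need not be in `L`; correcting `l` by a lattice point of `W`
    -- near `l - v` gives a bounded lattice representative.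
    obtain ⟨v, hv, hvn⟩ := Submodule.Quotient.norm_mk_lt ((W.mkQ.restrictScalars ℤ) l) one_pos
    have hlv : l - v ∈ W := by
      rw [← Submodule.Quotient.eq, hv]; rfl
    obtain ⟨l', hl', hn⟩ := hR' (l - v) (hW hlv)
    refine ⟨l - l', ⟨L.sub_mem hl hl'.1, ?_⟩, ?_⟩
    · have : l - l' = v + (l - v - l') := by abel
      rw [this]
      linarith [norm_add_le v (l - v - l')]
    · have h0 : W.mkQ l' = 0 := by simpa using hl'.2
      simp [map_sub, h0]
  · obtain ⟨R, hR⟩ := hL.cobounded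
    refine ⟨R, fun v ↦ ?_⟩
    obtain ⟨v, rfl⟩ := W.mkQ_surjective v
    obtain ⟨l, hl, hn⟩ := hR v
    refine ⟨W.mkQ l, ⟨l, hl, rfl⟩, ?_⟩
    rw [← map_sub]
    exact (Submodule.Quotient.norm_mk_le W (v - l)).trans hn

theorem map_nonneg_of_mem_span_nnreal {E : Type*} [AddCommGroup E] [Module ℝ E]
    (φ : E →ₗ[ℝ] ℝ) {s : Set E} (hs : ∀ g ∈ s, 0 ≤ φ g) {x : E}
    (hx : x ∈ Submodule.span ℝ≥0 s) : 0 ≤ φ x := by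
  induction hx using Submodule.span_induction with
  | mem x hx => exact hs x hx
  | zero => simp
  | add x y _ _ hx hy => rw [map_add]; exact add_nonneg hx hy
  | smul a x _ hx => rw [NNReal.smul_def, map_smul]; exact mul_nonneg a.2 hx

/-- By openness some `z ∈ C` near `y` has `c + y - z ∈ C`; adding `z` back gives `c + y ∈ C`, and
scaling gives the rest. -/
theorem ConvexCone.add_smul_mem_of_mem_closure {V : Type*} [NormedAddCommGroup V]
    [NormedSpace ℝ V] {C : ConvexCone ℝ V} (hC : IsOpen (C : Set V)) {c y : V} (hc : c ∈ C)
    (hy : y ∈ closure (C : Set V)) {t : ℝ} (ht : 0 ≤ t) : c + t • y ∈ C := by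
  have key : ∀ c ∈ C, c + y ∈ C := by
    intro c hc
    have ho : IsOpen {z | c + y - z ∈ (C : Set V)} := hC.preimage (by fun_prop)
    obtain ⟨z, hz, hzC⟩ := mem_closure_iff.1 hy _ ho (by simpa using hc)
    have := C.add_mem hz hzC
    rwa [sub_add_cancel] at this
  rcases ht.eq_or_lt with rfl | ht
  · simpa using hc
  · have := C.smul_mem ht (key _ (C.smul_mem (inv_pos.2 ht) hc))
    rwa [smul_add, smul_inv_smul₀ ht.ne'] at this

/-- Near a direction `y` in the closure of an open cone `C`, the far lattice points of `C` lie in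
a finitely generated cone with apex `p`, provided this holds modulo subspaces. -/
theorem exists_finset_cone_near_direction {V : Type*} [NormedAddCommGroup V] [NormedSpace ℝ V]
    [FiniteDimensional ℝ V] {L : Submodule ℤ V} {C : ConvexCone ℝ V}
    (hL : IsUniformLattice L) (hC : IsOpen (C : Set V)) {p : V} (hpC : p ∈ C) (hpL : p ∈ L) (M : ℝ)
    (ih : ∀ W : Submodule ℝ V, W ≠ ⊥ → W ≤ Submodule.span ℝ {l | l ∈ L ∧ l ∈ W} →
      ∃ F : Finset (V ⧸ W), (∀ f ∈ F, (∃ c ∈ C, W.mkQ c = f) ∧ ∃ l ∈ L, W.mkQ l = f) ∧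
        ∀ q ∈ C, q ∈ L → W.mkQ q - W.mkQ p ∈
          Submodule.span ℝ≥0 ((fun f ↦ f - W.mkQ p) '' (F : Set (V ⧸ W))))
    {y : V} (hy : y ∈ closure (C : Set V)) (hy1 : ‖y‖ = 1) :
    ∃ S ∈ nhds y, ∃ F : Finset V, ∃ R : ℝ, (∀ f ∈ F, f ∈ C ∧ f ∈ L ∧ M ≤ ‖f‖) ∧
      ∀ q ∈ C, q ∈ L → R ≤ ‖q‖ → ‖q‖⁻¹ • q ∈ S →
        q - p ∈ Submodule.span ℝ≥0 ((fun f ↦ f - p) '' (F : Set V)) := by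
  classical
  have near : ∀ c ∈ C, ∃ ε > 0, ∀ v, ‖v - c‖ < ε → v ∈ C := fun c hc ↦ by
    obtain ⟨ε, hε, h⟩ := Metric.isOpen_iff.1 hC c hc
    exact ⟨ε, hε, fun v hv ↦ h (by simpa [dist_eq_norm] using hv)⟩
  have far : ∀ (c l : V) (t ε : ℝ), ‖l - t • y - c‖ < ε → 0 ≤ t → t - ε - ‖c‖ ≤ ‖l‖ := by
    intro c l t ε h ht
    have h1 : ‖t • y‖ = t := by rw [norm_smul, hy1, mul_one, Real.norm_of_nonneg ht]
    have h2 : t • y = l - (l - t • y - c) - c := by abel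
    have h3 := norm_sub_le (l - (l - t • y - c)) c
    have h4 := norm_sub_le l (l - t • y - c)
    rw [← h2, h1] at h3
    linarith
  obtain ⟨W, hyW, hW⟩ := hL.exists_submodule_dense y
  obtain ⟨ε, hε, hball⟩ := near p hpC
  obtain ⟨N, hN, hNφ⟩ := exists_finset_near_ray hyW hW hε (max 0 (M + ε + ‖p‖))
  have hW0 : W ≠ ⊥ := by
    rintro rfl
    rw [Submodule.mem_bot] at hyW
    simp [hyW] at hy1
  -- A form killing the lattice points of `W` kills `N`; whichever of `±f` is nonpositive at `y`
  -- must then vanish on `W`.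
  have hWspan : W ≤ Submodule.span ℝ {l | l ∈ L ∧ l ∈ W} := by
    intro w hw
    by_contra hcon
    obtain ⟨f, hf, hker⟩ := Submodule.exists_le_ker_of_notMem hcon
    have hfN : ∀ l ∈ N, f l = 0 := fun l hl ↦
      hker (Submodule.subset_span ⟨(hN l hl).1, (hN l hl).2.1⟩)
    rcases le_total (f y) 0 with h | h
    · exact hf (hNφ f (fun l hl ↦ (hfN l hl).ge) h w hw)
    · exact hf (by simpa using hNφ (-f) (fun l hl ↦ by simp [hfN l hl]) (by simpa using h) w hw)
  obtain ⟨F', hF', hF'q⟩ := ih W hW0 hWspan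
  -- The lifts `c ∈ C` and `l ∈ L` may differ, but `c - l ∈ W`. Adding a lattice point of `W` near
  -- `t • y + (c - l)` moves `l` close to `c + t • y`, inside `C` and far out.
  have lift : ∀ f ∈ F', ∃ v, v ∈ C ∧ v ∈ L ∧ M ≤ ‖v‖ ∧ W.mkQ v = f := by
    intro f hf
    obtain ⟨⟨c, hc, hcf⟩, l, hl, hlf⟩ := hF' f hf
    obtain ⟨ε', hε', hball'⟩ := near c hc
    have hcl : c - l ∈ W := by
      rw [← W.ker_mkQ, LinearMap.mem_ker, map_sub, hcf, hlf, sub_self]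
    obtain ⟨l', hl', hl'W, t, ht, hlt⟩ := hW (c - l) hcl ε' hε' (max 0 (M + ε' + ‖c‖))
    have ht0 : 0 ≤ t := (le_max_left _ _).trans ht
    have e : l + l' - t • y - c = l' - t • y - (c - l) := by abel
    refine ⟨l + l', ?_, L.add_mem hl hl', ?_, ?_⟩
    · have := ConvexCone.add_smul_mem_of_mem_closure hC
        (hball' (l + l' - t • y) (by rwa [e])) hy ht0
      rwa [sub_add_cancel] at this
    · have := far c (l + l') t ε' (by rwa [e]) ht0
      linarith [(le_max_right _ _).trans ht]
    · have : W.mkQ l' = 0 := by simpa using hl'W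
      rw [map_add, this, add_zero, hlf]
  choose! g hgC hgL hgM hg using lift
  set F := N.image (fun l ↦ p + l) ∪ F'.image g with hF
  obtain ⟨Φ, hΦ⟩ := exists_finset_forms_span_nnreal_finite (F.image fun f ↦ f - p)
  rw [Finset.coe_image] at hΦ
  have hΦF : ∀ φ ∈ Φ, ∀ f ∈ F, 0 ≤ φ (f - p) := fun φ hφ f hf ↦
    (hΦ _).1 (Submodule.subset_span ⟨f, hf, rfl⟩) φ hφ
  -- On this neighbourhood `φ q > ‖q‖ * φ y / 2`, and the radius makes the right side at least `φ
  -- p`.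
  refine ⟨{u | ∀ φ ∈ Φ, 0 < φ y → φ y / 2 < φ u}, ?_, F,
    1 + ∑ φ ∈ Φ, |2 * φ p / φ y|, ?_, ?_⟩
  · rw [← Filter.eventually_iff, Filter.eventually_all_finset]
    intro φ hφ
    rw [Filter.eventually_imp_distrib_left]
    intro h
    have hcont : Continuous φ := φ.continuous_of_finiteDimensional
    exact hcont.continuousAt.eventually_const_lt (half_lt_self h)
  · intro f hf
    rcases Finset.mem_union.1 hf with hf | hf
    · obtain ⟨l, hl, rfl⟩ := Finset.mem_image.1 hf
      obtain ⟨hlL, hlW, t, ht, hlt⟩ := hN l hl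
      have ht0 : 0 ≤ t := (le_max_left _ _).trans ht
      have e : p + l - t • y - p = l - t • y := by abel
      refine ⟨?_, L.add_mem hpL hlL, ?_⟩
      · have := ConvexCone.add_smul_mem_of_mem_closure hC
          (hball (p + l - t • y) (by rwa [e])) hy ht0
        rwa [sub_add_cancel] at this
      · have := far p (p + l) t ε (by rwa [e]) ht0
        linarith [(le_max_right _ _).trans ht]
    · obtain ⟨f', hf', rfl⟩ := Finset.mem_image.1 hf
      exact ⟨hgC f' hf', hgL f' hf', hgM f' hf'⟩
  · intro q hqC hqL hqR hqS
    rw [hΦ]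
    intro φ hφ
    rcases lt_or_ge 0 (φ y) with h | h
    · have h1 : φ y / 2 < φ (‖q‖⁻¹ • q) := hqS φ hφ h
      have h2 : |2 * φ p / φ y| ≤ ∑ φ ∈ Φ, |2 * φ p / φ y| :=
        Finset.single_le_sum (f := fun φ : V →ₗ[ℝ] ℝ ↦ |2 * φ p / φ y|)
          (fun _ _ ↦ abs_nonneg _) hφ
      have h3 : 2 * φ p / φ y ≤ ‖q‖ := by linarith [le_abs_self (2 * φ p / φ y)]
      have h4 : 0 < ‖q‖ := by linarith [abs_nonneg (2 * φ p / φ y)]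
      rw [div_le_iff₀ h] at h3
      rw [map_smul, smul_eq_mul, inv_mul_eq_div, lt_div_iff₀ h4] at h1
      rw [map_sub]
      linarith
    · have hφW := hNφ φ (fun l hl ↦ by
        have := hΦF φ hφ (p + l) (Finset.mem_union_left _ (Finset.mem_image_of_mem _ hl))
        rwa [add_sub_cancel_left] at this) h
      have hle : W ≤ LinearMap.ker φ := fun w hw ↦ hφW w hw
      have := map_nonneg_of_mem_span_nnreal (W.liftQ φ hle) ?_ (hF'q q hqC hqL)
      · rwa [← map_sub, Submodule.mkQ_apply, Submodule.liftQ_apply] at this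
      · rintro _ ⟨f', hf', rfl⟩
        have h5 := hΦF φ hφ (g f') (Finset.mem_union_right _ (Finset.mem_image_of_mem _ hf'))
        rw [← hg f' hf']
        dsimp only
        rwa [← map_sub, Submodule.mkQ_apply, Submodule.liftQ_apply]

/-- Up to finitely many exceptions, the lattice points in an open convex cone lie in a cone with
apex a given lattice point `p` generated by finitely many lattice points, which can be chosen
arbitrarily far from the origin. -/
theorem exists_finset_cone_of_finrank.{u} (n : ℕ) : ∀ (V : Type u) [NormedAddCommGroup V]
    [NormedSpace ℝ V] [FiniteDimensional ℝ V] (L : Submodule ℤ V) (C : ConvexCone ℝ V) (p : V),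
    IsUniformLattice L → IsOpen (C : Set V) → p ∈ C → p ∈ L → Module.finrank ℝ V = n →
    ∀ M : ℝ, ∃ F : Finset V, ∃ R : ℝ, (∀ f ∈ F, f ∈ C ∧ f ∈ L ∧ M ≤ ‖f‖) ∧
      ∀ q ∈ C, q ∈ L → R ≤ ‖q‖ →
        q - p ∈ Submodule.span ℝ≥0 ((fun f ↦ f - p) '' (F : Set V)) := by
  induction n using Nat.strong_induction_on with
  | _ n IH =>
  intro V _ _ _ L C p hL hC hpC hpL hn M
  classical
  have ih : ∀ W : Submodule ℝ V, W ≠ ⊥ → W ≤ Submodule.span ℝ {l | l ∈ L ∧ l ∈ W} →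
      ∃ F : Finset (V ⧸ W), (∀ f ∈ F, (∃ c ∈ C, W.mkQ c = f) ∧ ∃ l ∈ L, W.mkQ l = f) ∧
        ∀ q ∈ C, q ∈ L → W.mkQ q - W.mkQ p ∈
          Submodule.span ℝ≥0 ((fun f ↦ f - W.mkQ p) '' (F : Set (V ⧸ W))) := by
    intro W hW0 hW
    have hcl : IsClosed (W : Set V) := W.closed_of_finiteDimensional
    have hlt : Module.finrank ℝ (V ⧸ W) < n := by
      have h1 := W.finrank_quotient_add_finrank
      have h2 : 0 < Module.finrank ℝ W := by
        have := Submodule.nontrivial_iff_ne_bot.2 hW0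
        exact Module.finrank_pos
      omega
    have hL' := hL.map_mkQ W hW
    obtain ⟨F, R, hF, hq⟩ := IH _ hlt (V ⧸ W) (L.map (W.mkQ.restrictScalars ℤ))
      (C.map W.mkQ) (W.mkQ p) hL' (by
        rw [ConvexCone.coe_map]
        exact W.isOpenMap_mkQ _ hC) ⟨p, hpC, rfl⟩ ⟨p, hpL, rfl⟩ rfl 0
    -- The finitely many exceptions in the quotient become generators themselves.
    refine ⟨F ∪ (hL'.finite R).toFinset.filter (fun f ↦ f ∈ C.map W.mkQ), ?_, ?_⟩
    · intro f hf
      rcases Finset.mem_union.1 hf with hf | hf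
      · exact ⟨(hF f hf).1, (hF f hf).2.1⟩
      · obtain ⟨h1, h2⟩ := Finset.mem_filter.1 hf
        exact ⟨h2, ((hL'.finite R).mem_toFinset.1 h1).1⟩
    · intro q hqC hqL
      rcases le_total R ‖W.mkQ q‖ with h | h
      · refine Submodule.span_mono (Set.image_mono ?_)
          (hq (W.mkQ q) ⟨q, hqC, rfl⟩ ⟨q, hqL, rfl⟩ h)
        simp
      · refine Submodule.subset_span ⟨W.mkQ q, ?_, rfl⟩
        refine Finset.mem_union_right _ (Finset.mem_filter.2 ⟨?_, ⟨q, hqC, rfl⟩⟩)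
        exact (hL'.finite R).mem_toFinset.2 ⟨⟨q, hqL, rfl⟩, h⟩
  have : ProperSpace V := FiniteDimensional.proper ℝ V
  have hcomp : IsCompact (closure (C : Set V) ∩ Metric.sphere 0 1) :=
    (isCompact_sphere _ _).inter_left isClosed_closure
  obtain ⟨F, R, hF, h⟩ := hcomp.induction_on
    (p := fun S ↦ ∃ F : Finset V, ∃ R : ℝ, (∀ f ∈ F, f ∈ C ∧ f ∈ L ∧ M ≤ ‖f‖) ∧
      ∀ q ∈ C, q ∈ L → R ≤ ‖q‖ → ‖q‖⁻¹ • q ∈ S →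
        q - p ∈ Submodule.span ℝ≥0 ((fun f ↦ f - p) '' (F : Set V)))
    ⟨∅, 0, by simp, by simp⟩
    (fun S T hST ⟨F, R, hF, h⟩ ↦ ⟨F, R, hF, fun q h1 h2 h3 h4 ↦ h q h1 h2 h3 (hST h4)⟩)
    (fun S T ⟨F₁, R₁, hF₁, h₁⟩ ⟨F₂, R₂, hF₂, h₂⟩ ↦ by
      refine ⟨F₁ ∪ F₂, max R₁ R₂, fun f hf ↦ ?_, fun q hqC hqL hqR hqS ↦ ?_⟩
      · exact (Finset.mem_union.1 hf).elim (hF₁ f) (hF₂ f)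
      · rcases hqS with hqS | hqS
        · refine Submodule.span_mono (Set.image_mono ?_)
            (h₁ q hqC hqL ((le_max_left _ _).trans hqR) hqS)
          simp
        · refine Submodule.span_mono (Set.image_mono ?_)
            (h₂ q hqC hqL ((le_max_right _ _).trans hqR) hqS)
          simp)
    (fun y hy ↦ by
      obtain ⟨S, hS, h⟩ := exists_finset_cone_near_direction hL hC hpC hpL M ih hy.1
        (by simpa using hy.2)
      exact ⟨S, mem_nhdsWithin_of_mem_nhds hS, h⟩)
  refine ⟨F, max R 1, hF, fun q hqC hqL hqR ↦ h q hqC hqL ((le_max_left _ _).trans hqR) ?_⟩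
  have hq0 : 0 < ‖q‖ := zero_lt_one.trans_le ((le_max_right _ _).trans hqR)
  refine ⟨subset_closure (C.smul_mem (inv_pos.2 hq0) hqC), ?_⟩
  simp [norm_smul, hq0.ne']

/-! ### Nondegenerate cones and a form controlling the norm -/

theorem ConvexCone.neg_notMem_closure {V : Type*} [NormedAddCommGroup V] [NormedSpace ℝ V]
    {C : ConvexCone ℝ V} (hCne : (C : Set V).Nonempty) (hC : IsOpen (C : Set V))
    (hCnd : IsNondegenerate (C : Set V)) {z : V} (hz : z ∈ closure (C : Set V)) (hz0 : z ≠ 0) :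
    -z ∉ closure (C : Set V) := by
  intro hneg
  obtain ⟨x, hx⟩ := hCne
  refine hCnd ⟨x, z, hz0, fun t ↦ ?_⟩
  rcases le_total 0 t with ht | ht
  · exact add_smul_mem_of_mem_closure hC hx hz ht
  · simpa using add_smul_mem_of_mem_closure hC hx hneg (neg_nonneg.2 ht)

/-- A closed convex cone is separated from each point outside it by a nonnegative functional. -/
theorem ConvexCone.exists_nonneg_neg_of_notMem_closure {V : Type*} [NormedAddCommGroup V]
    [NormedSpace ℝ V] {C : ConvexCone ℝ V} (hCne : (C : Set V).Nonempty) {z : V}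
    (hz : z ∉ closure (C : Set V)) :
    ∃ f : V →L[ℝ] ℝ, (∀ b ∈ closure (C : Set V), 0 ≤ f b) ∧ f z < 0 := by
  obtain ⟨f, u, hfu, hu⟩ := geometric_hahn_banach_point_closed C.convex.closure isClosed_closure hz
  have hsmul : ∀ b ∈ closure (C : Set V), ∀ t : ℝ, 0 < t → u < t * f b := fun b hb t ht ↦ by
    rw [← smul_eq_mul, ← map_smul]
    exact hu _ (C.closure.smul_mem ht hb)
  refine ⟨f, fun b hb ↦ ?_, ?_⟩
  · by_contra! h
    have := hsmul b hb ((|u| + 1) / -f b) (div_pos (by positivity) (by linarith))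
    rw [div_neg, neg_mul, div_mul_cancel₀ _ h.ne] at this
    linarith [neg_abs_le u]
  · by_contra! h
    obtain ⟨x, hx⟩ := hCne
    have hu0 : 0 < u := h.trans_lt hfu
    have hfx : 0 < f x := hu0.trans (hu x (subset_closure hx))
    have := hsmul x (subset_closure hx) (u / 2 / f x) (by positivity)
    rw [div_mul_cancel₀ _ hfx.ne'] at this
    linarith

/-- Each unit `z` in the closure has `-z` outside it, so some form nonnegative on the cone is
positive near `z`. By compactness a finite sum of such forms works. -/
theorem ConvexCone.exists_forall_mul_norm_le {V : Type*} [NormedAddCommGroup V]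
    [NormedSpace ℝ V] [FiniteDimensional ℝ V] {C : ConvexCone ℝ V}
    (hCne : (C : Set V).Nonempty) (hC : IsOpen (C : Set V))
    (hCnd : IsNondegenerate (C : Set V)) :
    ∃ η : V →L[ℝ] ℝ, ∃ u : ℝ, 0 < u ∧ ∀ x ∈ C, u * ‖x‖ ≤ η x := by
  have : ProperSpace V := FiniteDimensional.proper ℝ V
  have hcomp : IsCompact (closure (C : Set V) ∩ Metric.sphere 0 1) :=
    (isCompact_sphere _ _).inter_left isClosed_closure
  obtain ⟨η, -, u, hu0, hu⟩ := hcomp.induction_on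
    (p := fun S ↦ ∃ η : V →L[ℝ] ℝ, (∀ b ∈ closure (C : Set V), 0 ≤ η b) ∧
      ∃ u : ℝ, 0 < u ∧ ∀ x ∈ S, x ∈ closure (C : Set V) → u ≤ η x)
    ⟨0, by simp, 1, one_pos, by simp⟩
    (fun S T hST ⟨η, h, u, hu, hu'⟩ ↦ ⟨η, h, u, hu, fun x hx ↦ hu' x (hST hx)⟩)
    (fun S T ⟨η, h, u, hu, hu'⟩ ⟨η₂, h₂, u₂, hu₂, hu₂'⟩ ↦ by
      refine ⟨η + η₂, fun b hb ↦ add_nonneg (h b hb) (h₂ b hb), min u u₂, lt_min hu hu₂, ?_⟩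
      rintro x (hx | hx) hxC
      · exact (min_le_left _ _).trans <| (hu' x hx hxC).trans <|
          le_add_of_nonneg_right (h₂ x hxC)
      · exact (min_le_right _ _).trans <| (hu₂' x hx hxC).trans <|
          le_add_of_nonneg_left (h x hxC))
    (fun z ⟨hz, hz1⟩ ↦ by
      have hz0 : z ≠ 0 := by
        rintro rfl
        simp at hz1
      obtain ⟨f, hf, hfz⟩ := exists_nonneg_neg_of_notMem_closure hCne
        (neg_notMem_closure hCne hC hCnd hz hz0)
      rw [map_neg, neg_lt_zero] at hfz
      refine ⟨{x | f z / 2 < f x}, mem_nhdsWithin_of_mem_nhds ?_, f, hf, f z / 2, half_pos hfz,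
        fun x hx _ ↦ le_of_lt hx⟩
      exact f.continuous.continuousAt.eventually_const_lt (half_lt_self hfz))
  refine ⟨η, u, hu0, fun x hx ↦ ?_⟩
  rcases eq_or_ne x 0 with rfl | hx0
  · simp
  have hn : 0 < ‖x‖ := norm_pos_iff.2 hx0
  have hxc : ‖x‖⁻¹ • x ∈ closure (C : Set V) := subset_closure (C.smul_mem (inv_pos.2 hn) hx)
  have := hu (‖x‖⁻¹ • x) ⟨hxc, by simp [norm_smul, hn.ne']⟩ hxc
  rwa [map_smul, smul_eq_mul, inv_mul_eq_div, le_div_iff₀ hn] at this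

/-! ### Bounded parts of the hull -/

/-- The missing weight `1 - ∑ f ∈ F, b f` falls on `p`. -/
theorem Convex.add_sum_smul_sub_mem {V : Type*} [AddCommGroup V] [Module ℝ V] {s : Set V}
    (hs : Convex ℝ s) {p : V} (hp : p ∈ s) {F : Finset V} (hF : ∀ f ∈ F, f ∈ s) {b : V → ℝ}
    (hb : ∀ f ∈ F, 0 ≤ b f) (hb1 : ∑ f ∈ F, b f ≤ 1) : p + ∑ f ∈ F, b f • (f - p) ∈ s := by
  set B := ∑ f ∈ F, b f with hB
  rcases (Finset.sum_nonneg hb).eq_or_lt with h | h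
  · have : ∑ f ∈ F, b f • (f - p) = 0 := Finset.sum_eq_zero fun f hf ↦ by
      rw [(Finset.sum_eq_zero_iff_of_nonneg hb).1 h.symm f hf, zero_smul]
    rwa [this, add_zero]
  · rw [← hB] at h
    have hk : ∑ f ∈ F, (b f / B) • f ∈ s :=
      hs.sum_mem (fun f hf ↦ div_nonneg (hb f hf) h.le)
        (by rw [← Finset.sum_div, div_self h.ne']) hF
    have e : ∑ f ∈ F, b f • (f - p) = B • (∑ f ∈ F, (b f / B) • f - p) := by
      rw [smul_sub, Finset.smul_sum, hB, Finset.sum_smul, ← Finset.sum_sub_distrib, ← hB]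
      refine Finset.sum_congr rfl fun f _ ↦ ?_
      rw [smul_smul, mul_div_cancel₀ _ h.ne', smul_sub]
    rw [e]
    exact hs.add_smul_sub_mem hp hk ⟨h.le, hb1⟩

/-- Bounded parts of the convex hull of the lattice points in a nondegenerate open cone are
contained in the convex hull of finitely many of these points. -/
theorem exists_finset_forall_mem_convexHull {V : Type*} [NormedAddCommGroup V]
    [NormedSpace ℝ V] [FiniteDimensional ℝ V] {C : ConvexCone ℝ V}
    (hCne : (C : Set V).Nonempty) (hC : IsOpen (C : Set V))
    (hCnd : IsNondegenerate (C : Set V)) {L : Submodule ℤ V} (hL : IsUniformLattice L) (b : ℝ) :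
    ∃ F : Finset V, (F : Set V) ⊆ (C : Set V) ∩ (L : Set V) ∧
      ∀ x ∈ convexHull ℝ ((C : Set V) ∩ (L : Set V)), ‖x‖ ≤ b → x ∈ convexHull ℝ (F : Set V) := by
  classical
  obtain ⟨η, u, hu0, hu⟩ := ConvexCone.exists_forall_mul_norm_le hCne hC hCnd
  have hη0 : ∀ x ∈ C, 0 ≤ η x := fun x hx ↦ (by positivity : 0 ≤ u * ‖x‖).trans (hu x hx)
  -- `d` is the Carathéodory bound, `c` bounds `η x` when `‖x‖ ≤ b`, and `K` is chosen so that `c /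
  -- K ≤ 1 / d`.
  set d : ℝ := Module.finrank ℝ V + 1 with hd
  have hd0 : 0 < d := by positivity
  set c := ‖η‖ * |b| with hc
  have hc0 : 0 ≤ c := by positivity
  set K := d * (c + 1) with hK
  have hK0 : 0 < K := by positivity
  have hcone : ∀ p, p ∈ C → p ∈ L → ∃ F : Finset V, ∃ R : ℝ,
      (∀ f ∈ F, f ∈ C ∧ f ∈ L ∧ (d * c + K) / u ≤ ‖f‖) ∧ ∀ q ∈ C, q ∈ L → R ≤ ‖q‖ →
        q - p ∈ Submodule.span ℝ≥0 ((fun f ↦ f - p) '' (F : Set V)) := fun p hpC hpL ↦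
    exists_finset_cone_of_finrank _ V L C p hL hC hpC hpL rfl _
  choose! Fp Rp hFp hq using hcone
  set B : ℝ → Finset V := fun R ↦ (hL.finite R).toFinset.filter (fun l ↦ l ∈ C) with hB
  have memB : ∀ R l, l ∈ B R ↔ l ∈ C ∧ l ∈ L ∧ ‖l‖ ≤ R := fun R l ↦ by
    simp [hB, and_comm]
  set P := B (d * c / u) with hP
  set F := P ∪ P.biUnion (fun p ↦ Fp p ∪ B (Rp p)) with hF
  have hFX : (F : Set V) ⊆ (C : Set V) ∩ (L : Set V) := by
    intro f hf
    rw [Finset.mem_coe, hF, Finset.mem_union, Finset.mem_biUnion] at hf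
    rcases hf with hf | ⟨p, hp, hf⟩
    · have := (memB _ _).1 hf
      exact ⟨this.1, this.2.1⟩
    · have hp' := (memB _ _).1 hp
      rcases Finset.mem_union.1 hf with hf | hf
      · have := hFp p hp'.1 hp'.2.1 f hf
        exact ⟨this.1, this.2.1⟩
      · have := (memB _ _).1 hf
        exact ⟨this.1, this.2.1⟩
  refine ⟨F, hFX, fun x hx hxb ↦ ?_⟩
  obtain ⟨ι, _, z, w, hz, hai, hw, hw1, hsum⟩ := eq_pos_convex_span_of_mem_convexHull hx
  have hzX : ∀ i, z i ∈ C ∧ z i ∈ L := fun i ↦ hz ⟨i, rfl⟩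
  have hne : (Finset.univ : Finset ι).Nonempty := by
    by_contra hcon
    rw [Finset.not_nonempty_iff_eq_empty] at hcon
    simp [hcon] at hw1
  have hcard : (Fintype.card ι : ℝ) ≤ d := by
    have h1 := hai.card_le_finrank_succ
    have h2 := (vectorSpan ℝ (Set.range z)).finrank_le
    rw [hd]
    exact_mod_cast h1.trans (Nat.succ_le_succ h2)
  -- Some weight is at least the average, so `η (z i₀) ≤ d * c` confines `z i₀` to the finite set
  -- `P`.
  obtain ⟨i₀, -, hi₀⟩ := Finset.exists_le_of_sum_le (f := fun _ ↦ 1 / d) (g := w) hne (by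
    rw [hw1, Finset.sum_const, Finset.card_univ, nsmul_eq_mul, mul_one_div]
    exact (div_le_one hd0).2 hcard)
  have hηx : ∑ i, w i * η (z i) ≤ c := by
    have : η x = ∑ i, w i * η (z i) := by rw [← hsum, map_sum]; simp
    rw [← this]
    calc η x ≤ ‖η x‖ := le_abs_self _
      _ ≤ ‖η‖ * ‖x‖ := η.le_opNorm x
      _ ≤ c := by rw [hc]; gcongr; exact hxb.trans (le_abs_self b)
  set p := z i₀ with hp
  have hpC : p ∈ C := (hzX i₀).1
  have hpL : p ∈ L := (hzX i₀).2
  have hηp : η p ≤ d * c := by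
    have h1 : w i₀ * η p ≤ c := (Finset.single_le_sum (f := fun i ↦ w i * η (z i))
      (fun i _ ↦ mul_nonneg (hw i).le (hη0 _ (hzX i).1)) (Finset.mem_univ i₀)).trans hηx
    have h2 : 1 / d * η p ≤ c := (mul_le_mul_of_nonneg_right hi₀ (hη0 p hpC)).trans h1
    rwa [one_div, inv_mul_le_iff₀ hd0] at h2
  have hpP : p ∈ P := (memB _ _).2 ⟨hpC, hpL, by
    rw [le_div_iff₀ hu0]; linarith [hu p hpC]⟩
  have hsub : ∀ f ∈ Fp p ∪ B (Rp p), f ∈ F := fun f hf ↦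
    Finset.mem_union_right _ (Finset.mem_biUnion.2 ⟨p, hpP, hf⟩)
  -- A near `z i` is in `F` and costs 1. A far one costs at most `η (z i) / K`, because its
  -- generators satisfy `η f - η p ≥ K`. The saving at `i₀`, at least `1 / d`, pays for these.
  have key : ∀ i, ∃ a : V → ℝ, (∀ f, 0 ≤ a f) ∧ z i - p = ∑ f ∈ F, a f • (f - p) ∧
      ∑ f ∈ F, a f ≤ (if i = i₀ then 0 else 1) + η (z i) / K := by
    intro i
    have hηi : 0 ≤ η (z i) / K := div_nonneg (hη0 _ (hzX i).1) hK0.le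
    by_cases hi : i = i₀
    · exact ⟨0, by simp, by simp [hi, hp], by simpa [hi] using hi ▸ hηi⟩
    rw [if_neg hi]
    rcases le_total (Rp p) ‖z i‖ with h | h
    · have hs := hq p hpC hpL (z i) (hzX i).1 (hzX i).2 h
      obtain ⟨a, ha⟩ := (Submodule.mem_span_image_finset_iff_exists_fun' ℝ≥0).1 hs
      have hFpF : Fp p ⊆ F := fun f hf ↦ hsub f (Finset.mem_union_left _ hf)
      have hsum1 : z i - p = ∑ f ∈ Fp p, (a f : ℝ) • (f - p) := ha.symm
      refine ⟨fun f ↦ if f ∈ Fp p then a f else 0, fun f ↦ by positivity, ?_, ?_⟩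
      · rw [hsum1]
        simp only [ite_smul, zero_smul]
        rw [Finset.sum_ite_mem, Finset.inter_eq_right.2 hFpF]
      · rw [Finset.sum_ite_mem, Finset.inter_eq_right.2 hFpF]
        have h1 : η (z i) - η p = ∑ f ∈ Fp p, (a f : ℝ) * (η f - η p) := by
          rw [← map_sub, hsum1, map_sum]; simp
        have h2 : ∑ f ∈ Fp p, (a f : ℝ) * K ≤ ∑ f ∈ Fp p, (a f : ℝ) * (η f - η p) := by
          refine Finset.sum_le_sum fun f hf ↦ mul_le_mul_of_nonneg_left ?_ (a f).2
          obtain ⟨hfC, -, hfn⟩ := hFp p hpC hpL f hf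
          rw [div_le_iff₀ hu0] at hfn
          linarith [hu f hfC]
        rw [← Finset.sum_mul, ← h1] at h2
        have h3 : ∑ f ∈ Fp p, (a f : ℝ) ≤ η (z i) / K := by
          rw [le_div_iff₀ hK0]; linarith [hη0 p hpC]
        linarith
    · have hzF : z i ∈ F := hsub _ (Finset.mem_union_right _
        ((memB _ _).2 ⟨(hzX i).1, (hzX i).2, h⟩))
      refine ⟨fun f ↦ if f = z i then 1 else 0, fun f ↦ by positivity, ?_, ?_⟩
      · simp [hzF]
      · simpa [hzF] using hηi
  choose a ha0 hasum hale using key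
  have hx' : x = p + ∑ f ∈ F, (∑ i, w i * a i f) • (f - p) := by
    have h1 : x = p + ∑ i, w i • (z i - p) := by
      simp only [smul_sub, Finset.sum_sub_distrib]
      rw [hsum, ← Finset.sum_smul, hw1, one_smul]; abel
    rw [h1]
    congr 1
    simp only [Finset.sum_smul]
    rw [Finset.sum_comm]
    refine Finset.sum_congr rfl fun i _ ↦ ?_
    rw [hasum i, Finset.smul_sum]
    simp only [smul_smul]
  rw [hx']
  refine (convex_convexHull ℝ _).add_sum_smul_sub_mem
    (subset_convexHull ℝ _ (Finset.mem_union_left _ hpP))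
    (fun f hf ↦ subset_convexHull ℝ _ hf)
    (fun f _ ↦ Finset.sum_nonneg fun i _ ↦ mul_nonneg (hw i).le (ha0 i f)) ?_
  rw [Finset.sum_comm]
  calc ∑ i, ∑ f ∈ F, w i * a i f
      = ∑ i, w i * ∑ f ∈ F, a i f := by simp only [Finset.mul_sum]
    _ ≤ ∑ i, w i * ((if i = i₀ then 0 else 1) + η (z i) / K) :=
        Finset.sum_le_sum fun i _ ↦ mul_le_mul_of_nonneg_left (hale i) (hw i).le
    _ = ∑ i, (w i - (if i = i₀ then w i else 0) + w i * η (z i) / K) := by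
        refine Finset.sum_congr rfl fun i _ ↦ ?_
        split_ifs <;> ring
    _ = 1 - w i₀ + (∑ i, w i * η (z i)) / K := by
        rw [Finset.sum_add_distrib, Finset.sum_sub_distrib, hw1, Finset.sum_div]; simp
    _ ≤ 1 - 1 / d + c / K := by gcongr
    _ ≤ 1 := by
        have : c / K ≤ 1 / d := by
          rw [hK, div_le_div_iff₀ (by positivity) hd0]; nlinarith
        linarith

/-! ### Rationality of lattice polytopes -/

theorem IsRationalPolyhedron.inter {V : Type*} [AddCommGroup V] [Module ℝ V]
    {L : Submodule ℤ V} {P Q : Set V} (hP : IsRationalPolyhedron L P)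
    (hQ : IsRationalPolyhedron L Q) : IsRationalPolyhedron L (P ∩ Q) := by
  classical
  obtain ⟨S, hS, rfl⟩ := hP
  obtain ⟨T, hT, rfl⟩ := hQ
  refine ⟨S ∪ T, fun f hf ↦ (Finset.mem_union.1 hf).elim (hS f) (hT f), ?_⟩
  ext x
  simp only [Set.mem_inter_iff, Set.mem_ofPred_eq, Finset.mem_union]
  exact ⟨fun h f hf ↦ hf.elim (h.1 f) (h.2 f), fun h ↦ ⟨fun f hf ↦ h f (Or.inl hf),
    fun f hf ↦ h f (Or.inr hf)⟩⟩

/-- Homogenisation: the last coordinate records the sum of the weights. -/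
theorem mem_convexHull_finset_iff_mem_span_nnreal {V : Type*} [AddCommGroup V] [Module ℝ V]
    (F : Finset V) (x : V) :
    x ∈ convexHull ℝ (F : Set V) ↔
      ((x, 1) : V × ℝ) ∈ Submodule.span ℝ≥0 ((fun f ↦ ((f, 1) : V × ℝ)) '' (F : Set V)) := by
  constructor
  · intro h
    refine convexHull_min (t := {x | ((x, 1) : V × ℝ) ∈
      Submodule.span ℝ≥0 ((fun f ↦ ((f, 1) : V × ℝ)) '' (F : Set V))}) ?_ ?_ h
    · exact fun f hf ↦ Submodule.subset_span ⟨f, hf, rfl⟩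
    · intro a ha b hb s t hs ht hst
      have ha' : ((a, 1) : V × ℝ) ∈
        Submodule.span ℝ≥0 ((fun f ↦ ((f, 1) : V × ℝ)) '' (F : Set V)) := ha
      have hb' : ((b, 1) : V × ℝ) ∈
        Submodule.span ℝ≥0 ((fun f ↦ ((f, 1) : V × ℝ)) '' (F : Set V)) := hb
      change ((s • a + t • b, 1) : V × ℝ) ∈
        Submodule.span ℝ≥0 ((fun f ↦ ((f, 1) : V × ℝ)) '' (F : Set V))
      have e : ((s • a + t • b, 1) : V × ℝ) =
          s.toNNReal • ((a, 1) : V × ℝ) + t.toNNReal • ((b, 1) : V × ℝ) := by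
        rw [NNReal.smul_def, NNReal.smul_def, Real.coe_toNNReal s hs, Real.coe_toNNReal t ht]
        simp [hst]
      rw [e]
      exact Submodule.add_mem _ (Submodule.smul_mem _ _ ha') (Submodule.smul_mem _ _ hb')
  · intro h
    obtain ⟨a, ha⟩ := (Submodule.mem_span_image_finset_iff_exists_fun' ℝ≥0).1 h
    have h1 : ∑ f ∈ F, (a f : ℝ) • f = x := by
      have := congrArg Prod.fst ha
      rw [Prod.fst_sum] at this
      exact this
    have h2 : ∑ f ∈ F, (a f : ℝ) = 1 := by
      have := congrArg Prod.snd ha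
      rw [Prod.snd_sum] at this
      simpa [NNReal.smul_def] using this
    rw [← h1]
    exact (convex_convexHull ℝ _).sum_mem (fun f _ ↦ (a f).2) h2
      fun f hf ↦ subset_convexHull ℝ _ hf

/-- A lattice polytope is a rational polyhedron. -/
theorem isRationalPolyhedron_convexHull {V : Type*} [NormedAddCommGroup V] [NormedSpace ℝ V]
    [FiniteDimensional ℝ V] (L : Submodule ℤ V) [DiscreteTopology L] [IsZLattice ℝ L]
    (F : Finset V) (hF : (F : Set V) ⊆ L) : IsRationalPolyhedron L (convexHull ℝ (F : Set V)) := by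
  classical
  have : ProperSpace V := FiniteDimensional.proper ℝ V
  have : Module.Finite ℤ L := ZLattice.module_finite ℝ L
  have : Module.Free ℤ L := ZLattice.module_free ℝ L
  set K := (algebraMap ℚ ℝ).range
  set Γ : Set (V × ℝ) := {x | x.1 ∈ L ∧ x.2 = 1} with hΓ
  set b₀ := Module.Free.chooseBasis ℤ L
  set b := b₀.ofZLatticeBasis ℝ L with hb
  obtain ⟨Φ, hΦK, hΦ⟩ := exists_finset_forms_span_nnreal K Γ
    ⟨insert (LinearMap.snd ℝ V ℝ) (Finset.univ.image fun i ↦ b.coord i ∘ₗ LinearMap.fst ℝ V ℝ),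
      by
        rintro φ hφ x ⟨hx, hx1⟩
        rcases Finset.mem_insert.1 hφ with rfl | hφ
        · exact ⟨1, by simp [hx1]⟩
        · obtain ⟨i, -, rfl⟩ := Finset.mem_image.1 hφ
          refine ⟨(b₀.repr ⟨x.1, hx⟩ i : ℤ), ?_⟩
          have := b₀.ofZLatticeBasis_repr_apply ℝ L ⟨x.1, hx⟩ i
          simp [hb, this],
      fun x hx ↦ by
        refine Prod.ext (b.ext_elem fun i ↦ ?_) ?_
        · simpa using hx (b.coord i ∘ₗ LinearMap.fst ℝ V ℝ) (Finset.mem_insert_of_mem (by simp))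
        · exact hx (LinearMap.snd ℝ V ℝ) (Finset.mem_insert_self _ _)⟩
    (F.image fun f ↦ (f, 1)) (fun g hg ↦ by
      obtain ⟨f, hf, rfl⟩ := Finset.mem_image.1 hg
      exact ⟨hF hf, rfl⟩)
  rw [Finset.coe_image] at hΦ
  set A : ((V × ℝ) →ₗ[ℝ] ℝ) → (V →ᵃ[ℝ] ℝ) := fun φ ↦
    (φ ∘ₗ LinearMap.inl ℝ V ℝ).toAffineMap + AffineMap.const ℝ V (φ (0, 1)) with hA
  have hAx : ∀ φ x, A φ x = φ (x, 1) := fun φ x ↦ by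
    have : ((x, 1) : V × ℝ) = (x, 0) + (0, 1) := by simp
    rw [this, map_add]; rfl
  refine ⟨Φ.image A, fun f hf x hx ↦ ?_, ?_⟩
  · obtain ⟨φ, hφ, rfl⟩ := Finset.mem_image.1 hf
    obtain ⟨n, hn, hnx⟩ := hx
    -- The values at `(n • x, 1)` and `(0, 1)`, both in `Γ`, are rational and determine the value at
    -- `(x, 1)`.
    obtain ⟨q, hq⟩ := hΦK φ hφ (n • x, 1) ⟨hnx, rfl⟩
    obtain ⟨r, hr⟩ := hΦK φ hφ (0, 1) ⟨L.zero_mem, rfl⟩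
    simp only [eq_ratCast] at hq hr
    refine ⟨(q - r) / n + r, ?_⟩
    have hn' : (n : ℝ) ≠ 0 := by exact_mod_cast hn.ne'
    have h1 : ((n • x, 1) : V × ℝ) = (n : ℝ) • (x, 0) + (0, 1) := by
      simp [Int.cast_smul_eq_zsmul]
    have h2 : ((x, 1) : V × ℝ) = (x, 0) + (0, 1) := by simp
    rw [h1, map_add, map_smul, ← hr, smul_eq_mul] at hq
    rw [hAx, h2, map_add, ← hr]
    push_cast
    field_simp
    linarith
  · ext x
    rw [mem_convexHull_finset_iff_mem_span_nnreal, hΦ]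
    simp [hAx]

theorem theorem2p1 {V : Type*} [NormedAddCommGroup V] [NormedSpace ℝ V] [FiniteDimensional ℝ V]
    (C : ConvexCone ℝ V) (hCne : (C : Set V).Nonempty) (hCopen : IsOpen (C : Set V))
    (hCnd : IsNondegenerate (C : Set V))
    (L : Submodule ℤ V) [DiscreteTopology L] [IsZLattice ℝ L] :
    IsBoundedlyRationallyPolyhedral L (convexHull ℝ ((C : Set V) ∩ (L : Set V))) ∧
      IsClosed (convexHull ℝ ((C : Set V) ∩ (L : Set V))) := by
  have hfin := exists_finset_forall_mem_convexHull hCne hCopen hCnd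
    (isUniformLattice_of_isZLattice L)
  constructor
  · intro P hP hbdd
    obtain ⟨b, hb⟩ := hbdd.exists_norm_le
    obtain ⟨F, hF, h⟩ := hfin b
    have : convexHull ℝ ((C : Set V) ∩ (L : Set V)) ∩ P = convexHull ℝ (F : Set V) ∩ P :=
      Set.Subset.antisymm (fun x hx ↦ ⟨h x hx.1 (hb x hx.2), hx.2⟩)
        (Set.inter_subset_inter_left _ (convexHull_mono hF))
    rw [this]
    exact (isRationalPolyhedron_convexHull L F (hF.trans Set.inter_subset_right)).inter hP
  · refine isClosed_of_closure_subset fun x hx ↦ ?_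
    -- The unit ball around `x` meets the hull inside one closed polytope, which therefore contains
    -- `x`.
    obtain ⟨F, hF, h⟩ := hfin (‖x‖ + 1)
    have hcl : IsClosed (convexHull ℝ (F : Set V)) := F.finite_toSet.isClosed_convexHull ℝ
    refine convexHull_mono hF (hcl.closure_subset_iff.2 ?_
      (Metric.isOpen_ball.inter_closure ⟨Metric.mem_ball_self one_pos, hx⟩))
    rintro z ⟨hz, hzK⟩
    refine h z hzK ?_
    rw [mem_ball_iff_norm] at hz
    linarith [norm_le_norm_add_norm_sub' z x]
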